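/- For $d\ge 1$ let $\mathbb B^d$ be the open unit ball of $\mathbb C^d$ and $\mathrm{Aut}(\mathbb B^d)$ its group of holomorphic automorphisms; let $\mathbf U(n)\le \mathrm{Aut}(\mathbb B^n)$ be the subgroup of (restrictions of) unitary maps. For a proper map $f:\mathbb B^n\to\mathbb B^N$ let $\Gamma_f$ be its Hermitian invariant group, i.e. the group of all $\gamma\in\mathrm{Aut}(\mathbb B^n)$ for which there is $\psi\in\mathrm{Aut}(\mathbb B^N)$ with $f\circ\gamma=\psi\circ f$. For a subgroup $\Gamma\le\mathrm{Aut}(\mathbb B^n)$ let $$\mathbf S(\Gamma)=\min\Big(n-\sum_{k_j\ge1}(k_j-1)\Big),$$ the minimum being over all finite families of integers $k_1,\dots,k_J\ge 0$ with $\sum_j k_j\le n$ such that the block diagonal group $\mathbf U(k_1)\oplus\cdots\oplus\mathbf U(k_J)$ (acting on consecutive blocks of coordinates and fixing the remaining coordinates; $\mathbf U(0)$ is trivial) is contained in $\Gamma$. The source rank of $f$ is $\mathbf s(f)=\min_{\gamma\in\mathrm{Aut}(\mathbb B^n)}\mathbf S(\gamma^{-1}\circ\Gamma_f\circ\gamma)$.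 Let $z\mapsto z^{\otimes m}\in\mathbb C^{n^m}$ be the tensor power, whose coordinates are all the products $z_{i_1}\cdots z_{i_m}$ with $1\le i_1,\dots,i_m\le n$. **Theorem.** Let $n\ge 1$, let $\lambda=(\lambda_1,\dots,\lambda_k)\in\mathbb C^k$ with $\|\lambda\|=1$, and let $m_1,\dots,m_k$ be distinct non-negative integers such that $\lambda_j\ne0$ for some $j$ with $m_j\ge1$. Put $$f(z)=\lambda_1z^{\otimes m_1}\oplus\cdots\oplus\lambda_kz^{\otimes m_k}.$$ 1. The identity map $f(z)=z$ is a proper map from $\mathbb B^n$ to itself, $\Gamma_f=\mathrm{Aut}(\mathbb B^n)$, and $\mathbf s(f)=1$. 2. If $m\ge2$, then $f(z)=z^{\otimes m}$ is a proper map between balls, $\Gamma_f=\mathbf U(n)$, and $\mathbf s(f)=1$. 3. If $\lambda_j\neq 0$ for some $j$ with $m_j\ge2$, then $f$ is a proper map between balls, $\Gamma_f=\mathbf U(n)$, and $\mathbf s(f)=1$. 4. If $k=2$ and $(m_1,m_2)=(0,1)$, so that $f(z)=\lambda_1\oplus\lambda_2z$ with $\lambda_2\ne0$, then $f$ is a proper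 map between balls, $\Gamma_f=\mathrm{Aut}(\mathbb B^n)$, and $\mathbf s(f)=1$. -/

import Mathlib

/-- The open unit ball `𝔹` of the complex Euclidean space `ℂ^ι`
(so `unitBall (Fin n)` is `𝔹ⁿ`). -/
abbrev unitBall (ι : Type) [Fintype ι] : Set (EuclideanSpace ℂ ι) :=
  Metric.ball 0 1

/-- A map between unit balls is holomorphic if it is the restriction of a function that is complex
differentiable on the (open) unit ball. -/
def IsHolo {ι κ : Type} [Fintype ι] [Fintype κ] (g : unitBall ι → unitBall κ) : Prop :=
  ∃ F : EuclideanSpace ℂ ι → EuclideanSpace ℂ κ,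
    DifferentiableOn ℂ F (unitBall ι) ∧ ∀ z : unitBall ι, F z = g z

theorem IsHolo.comp {ι κ τ : Type} [Fintype ι] [Fintype κ] [Fintype τ]
    {g : unitBall κ → unitBall τ} {h : unitBall ι → unitBall κ}
    (hg : IsHolo g) (hh : IsHolo h) : IsHolo (fun z => g (h z)) := by
  obtain ⟨G, hG, hG'⟩ := hg
  obtain ⟨H, hH, hH'⟩ := hh
  refine ⟨G ∘ H, hG.comp hH ?_, ?_⟩
  · intro z hz
    have := hH' ⟨z, hz⟩
    simp only at this
    rw [this]
    exact (h ⟨z, hz⟩).2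
  · intro z
    simp only [Function.comp_apply, hH', hG']

/-- The holomorphic automorphism group `Aut(𝔹)`: all bijections of the ball onto itself that are
holomorphic together with their inverse; the product is composition. -/
def ballAut (ι : Type) [Fintype ι] : Subgroup (Equiv.Perm (unitBall ι)) where
  carrier := {e | IsHolo (fun z => e z) ∧ IsHolo (fun z => e.symm z)}
  mul_mem' := by
    rintro a b ⟨ha, ha'⟩ ⟨hb, hb'⟩
    exact ⟨ha.comp hb, hb'.comp ha'⟩
  one_mem' := ⟨⟨id, differentiableOn_id, fun _ => rfl⟩, ⟨id, differentiableOn_id, fun _ => rfl⟩⟩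
  inv_mem' := by
    rintro a ⟨ha, ha'⟩
    exact ⟨ha', ha⟩

/-- The Hermitian invariant group `Γ_f` of a map `f` between balls: all source automorphisms `γ`
for which there is a target automorphism `ψ` with `f ∘ γ = ψ ∘ f`. -/
def hermitianGroup {ι κ : Type} [Fintype ι] [Fintype κ] (f : unitBall ι → unitBall κ) :
    Subgroup (ballAut ι) where
  carrier := {γ | ∃ ψ : ballAut κ, ∀ z, f (γ.1 z) = ψ.1 (f z)}
  mul_mem' := by
    rintro a b ⟨p, hp⟩ ⟨q, hq⟩
    exact ⟨p * q, fun z => by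
      simp only [Subgroup.coe_mul, Equiv.Perm.mul_apply, hp, hq]⟩
  one_mem' := ⟨1, fun _ => rfl⟩
  inv_mem' := by
    rintro a ⟨p, hp⟩
    refine ⟨p⁻¹, fun z => ?_⟩
    have h := hp ((a⁻¹).1 z)
    have e : a.1 ((a⁻¹).1 z) = z := a.1.apply_symm_apply z
    rw [e] at h
    rw [h]
    exact (p.1.symm_apply_apply _).symm

/-- The unitary group of `ℂⁿ`: its linear isometric automorphisms. -/
abbrev unitaryMaps (n : ℕ) : Type := EuclideanSpace ℂ (Fin n) ≃ₗᵢ[ℂ] EuclideanSpace ℂ (Fin n)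

theorem unitaryMaps.mem_ball {n : ℕ} (U : unitaryMaps n) {z : EuclideanSpace ℂ (Fin n)}
    (hz : z ∈ unitBall (Fin n)) : U z ∈ unitBall (Fin n) := by
  simpa using hz

/-- A unitary map, restricted to the unit ball, as an automorphism of the ball. -/
noncomputable def unitaryToAut (n : ℕ) : unitaryMaps n →* ballAut (Fin n) where
  toFun U :=
    ⟨{ toFun := fun z => ⟨U z, U.mem_ball z.2⟩
       invFun := fun z => ⟨U.symm z, unitaryMaps.mem_ball U.symm z.2⟩
       left_inv := fun z => by simp
       right_inv := fun z => by simp },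
     ⟨U, U.differentiable.differentiableOn, fun _ => rfl⟩,
     ⟨U.symm, U.symm.differentiable.differentiableOn, fun _ => rfl⟩⟩
  map_one' := rfl
  map_mul' _ _ := rfl

/-- `U(n)` as a subgroup of `Aut(𝔹ⁿ)`. -/
noncomputable def unitaryAut (n : ℕ) : Subgroup (ballAut (Fin n)) := (unitaryToAut n).range

/-- For block sizes `k₀, …, k_{J-1}`, the coordinates `i` and `i'` lie in the same one of the
consecutive blocks of these sizes; the block `j` starts at `k₀ + … + k_{j-1}`. -/
def SameBlock {J : ℕ} (k : Fin J → ℕ) (i i' : ℕ) : Prop :=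
  ∃ j : Fin J, (∑ l ∈ Finset.Iio j, k l ≤ i ∧ i < ∑ l ∈ Finset.Iic j, k l) ∧
    (∑ l ∈ Finset.Iio j, k l ≤ i' ∧ i' < ∑ l ∈ Finset.Iic j, k l)

theorem SameBlock.symm {J : ℕ} {k : Fin J → ℕ} {i i' : ℕ} (h : SameBlock k i i') :
    SameBlock k i' i := by
  obtain ⟨j, h1, h2⟩ := h
  exact ⟨j, h2, h1⟩

/-- The matrix entry of a linear isometry in the standard basis (row `i'`, column `i`). -/
noncomputable def unitaryEntry {n : ℕ} (U : unitaryMaps n) (i' i : Fin n) : ℂ :=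
  U (EuclideanSpace.single i 1) i'

theorem unitaryEntry_one {n : ℕ} (i' i : Fin n) :
    unitaryEntry (1 : unitaryMaps n) i' i = if i' = i then 1 else 0 := by
  simp [unitaryEntry]

theorem unitaryEntry_mul {n : ℕ} (U V : unitaryMaps n) (i' i : Fin n) :
    unitaryEntry (U * V) i' i = ∑ l, unitaryEntry U i' l * unitaryEntry V l i := by
  have h : V (EuclideanSpace.single i 1) =
      ∑ l, (V (EuclideanSpace.single i 1) l) • EuclideanSpace.single l (1 : ℂ) := by
    ext x
    simp [Pi.single_apply]
  unfold unitaryEntry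
  rw [LinearIsometryEquiv.coe_mul, Function.comp_apply, h, map_sum]
  simp [mul_comm, Pi.single_apply]

theorem unitaryEntry_inv {n : ℕ} (U : unitaryMaps n) (i' i : Fin n) :
    unitaryEntry U⁻¹ i' i = (starRingEnd ℂ) (unitaryEntry U i i') := by
  have h := LinearIsometryEquiv.inner_map_map U
    (EuclideanSpace.single i' (1 : ℂ)) (U⁻¹ (EuclideanSpace.single i (1 : ℂ)))
  have h2 : U (U⁻¹ (EuclideanSpace.single i (1 : ℂ))) = EuclideanSpace.single i (1 : ℂ) :=
    U.apply_symm_apply _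
  rw [h2] at h
  simpa [unitaryEntry, EuclideanSpace.inner_single_left,
    EuclideanSpace.inner_single_right] using h.symm

/-- The block diagonal group `U(k₀) ⊕ ⋯ ⊕ U(k_{J-1})` inside the unitary group of `ℂⁿ`: outside of
the diagonal blocks the matrix agrees with the identity matrix, so the remaining coordinates
are fixed. -/
noncomputable def blockUnitary {J : ℕ} (n : ℕ) (k : Fin J → ℕ) : Subgroup (unitaryMaps n) where
  carrier := {U | ∀ i' i : Fin n, ¬ SameBlock k i' i →
    unitaryEntry U i' i = if i' = i then 1 else 0}
  one_mem' i' i _ := unitaryEntry_one i' i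
  mul_mem' := by
    intro U V hU hV i' i h
    rw [unitaryEntry_mul]
    by_cases hs : SameBlock k i i
    · have hii : i' ≠ i := fun e => h (e ▸ hs)
      rw [if_neg hii]
      refine Finset.sum_eq_zero fun l _ => ?_
      by_cases hl : SameBlock k l i
      · have hl' : ¬ SameBlock k i' l := by
          rintro ⟨j, a, b⟩
          obtain ⟨j', c, d⟩ := hl
          have hj : j = j' := by
            rcases lt_trichotomy j j' with hlt | heq | hgt
            · have := Finset.sum_le_sum_of_subset (f := k)
                (fun x hx => Finset.mem_Iio.2 (lt_of_le_of_lt (Finset.mem_Iic.1 hx) hlt) :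
                  Finset.Iic j ⊆ Finset.Iio j')
              omega
            · exact heq
            · have := Finset.sum_le_sum_of_subset (f := k)
                (fun x hx => Finset.mem_Iio.2 (lt_of_le_of_lt (Finset.mem_Iic.1 hx) hgt) :
                  Finset.Iic j' ⊆ Finset.Iio j)
              omega
          subst hj
          exact h ⟨j, a, d⟩
        have hne : i' ≠ l := fun e => h (e ▸ hl)
        rw [hU i' l hl', if_neg hne, zero_mul]
      · have hne : l ≠ i := fun e => hl (e ▸ hs)
        rw [hV l i hl, if_neg hne, mul_zero]
    · have hl : ∀ l : Fin n, ¬ SameBlock k l i := by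
        rintro l ⟨j, _, b⟩
        exact hs ⟨j, b, b⟩
      rw [Finset.sum_eq_single i]
      · rw [hV i i hs, if_pos rfl, mul_one, hU i' i h]
      · intro l _ hne
        rw [hV l i (hl l), if_neg hne, mul_zero]
      · simp
  inv_mem' := by
    intro U hU i' i h
    rw [unitaryEntry_inv, hU i i' (fun hs => h hs.symm)]
    by_cases e : i' = i
    · simp [e]
    · simp [e, Ne.symm e]

/-- The possible values `n - ∑_{k_j ≥ 1} (k_j - 1)`, over all groups `U(k₀) ⊕ ⋯ ⊕ U(k_{J-1})` with
`∑ k_j ≤ n` that are contained in `Γ`. (Truncated subtraction makes the terms with `k_j = 0` vanish,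
and the outer subtraction is never truncated, because `∑ (k_j - 1) ≤ ∑ k_j ≤ n`.) -/
def blockValues {n : ℕ} (Γ : Subgroup (ballAut (Fin n))) : Set ℕ :=
  {s | ∃ (J : ℕ) (k : Fin J → ℕ), ∑ j, k j ≤ n ∧
    (blockUnitary n k).map (unitaryToAut n) ≤ Γ ∧ s = n - ∑ j, (k j - 1)}

/-- The integer `S(Γ)`, the minimum of the (nonempty) set `blockValues Γ`. -/
noncomputable def rankOfGroup {n : ℕ} (Γ : Subgroup (ballAut (Fin n))) : ℕ :=
  sInf (blockValues Γ)

/-- The source rank `s(f)`: the minimum of `S(γ⁻¹ ∘ Γ_f ∘ γ)` over all automorphisms `γ` of the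
source ball. -/
noncomputable def sourceRank {n : ℕ} {κ : Type} [Fintype κ]
    (f : unitBall (Fin n) → unitBall κ) : ℕ :=
  ⨅ γ : ballAut (Fin n), rankOfGroup ((hermitianGroup f).map (MulAut.conj γ⁻¹).toMonoidHom)

/-- The tensor power `z ↦ z^{⊗m}` from `ℂⁿ` to `(ℂⁿ)^{⊗m} = ℂ^{n^m}`, in the standard orthonormal
basis: the coordinates are all the products `z_{I 0} ⋯ z_{I (m-1)}`. -/
noncomputable def tensorPower (n m : ℕ) (z : EuclideanSpace ℂ (Fin n)) :
    EuclideanSpace ℂ (Fin m → Fin n) :=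
  WithLp.toLp 2 fun I => ∏ i, z (I i)

/-- The juxtaposition `J_λ(g₁, …, g_k) = λ₁ g₁ ⊕ ⋯ ⊕ λ_k g_k` into the orthogonal sum of the
target spaces. -/
noncomputable def juxtapose {E : Type} {k : ℕ} {κ : Fin k → Type}
    (lam : EuclideanSpace ℂ (Fin k)) (g : (j : Fin k) → E → EuclideanSpace ℂ (κ j)) (z : E) :
    EuclideanSpace ℂ (Σ j, κ j) :=
  WithLp.toLp 2 fun p => lam p.1 * g p.1 z p.2

theorem norm_tensorPower (n m : ℕ) (z : EuclideanSpace ℂ (Fin n)) :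
    ‖tensorPower n m z‖ = ‖z‖ ^ m := by
  refine (sq_eq_sq₀ (norm_nonneg _) (by positivity)).1 ?_
  rw [EuclideanSpace.norm_sq_eq, ← pow_mul, mul_comm m 2, pow_mul, EuclideanSpace.norm_sq_eq]
  simp only [tensorPower, norm_prod, ← Finset.prod_pow]
  rw [Finset.sum_pow']
  simp [Fintype.piFinset_univ]

theorem norm_sq_juxtapose {E : Type} {k : ℕ} {κ : Fin k → Type} [∀ j, Fintype (κ j)]
    (lam : EuclideanSpace ℂ (Fin k)) (g : (j : Fin k) → E → EuclideanSpace ℂ (κ j)) (z : E) :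
    ‖juxtapose lam g z‖ ^ 2 = ∑ j, ‖lam j‖ ^ 2 * ‖g j z‖ ^ 2 := by
  simp only [EuclideanSpace.norm_sq_eq, juxtapose, norm_mul, mul_pow, Fintype.sum_sigma,
    Finset.mul_sum]

/-- For `m ≠ 0`, the tensor power `z ↦ z^{⊗m}` as a map between unit balls. -/
noncomputable def tensorPowerBall (n m : ℕ) (hm : m ≠ 0) (z : unitBall (Fin n)) :
    unitBall (Fin m → Fin n) :=
  ⟨tensorPower n m z, by
    have hz := z.2
    rw [mem_ball_zero_iff] at hz ⊢
    rw [norm_tensorPower]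
    exact pow_lt_one₀ (norm_nonneg _) hz hm⟩

/-- For `‖λ‖ = 1`, the map `z ↦ λ₁ z^{⊗m₁} ⊕ ⋯ ⊕ λ_k z^{⊗m_k}` as a map between unit balls. It sends
the open ball into the open ball exactly when it is not formally constant, i.e. when `λ_j ≠ 0`
for some `m_j ≠ 0`. -/
noncomputable def tensorSumBall (n : ℕ) {k : ℕ} (lam : EuclideanSpace ℂ (Fin k)) (m : Fin k → ℕ)
    (hlam : ‖lam‖ = 1) (hm : ∃ j, m j ≠ 0 ∧ lam j ≠ 0) (z : unitBall (Fin n)) :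
    unitBall (Σ j, (Fin (m j) → Fin n)) :=
  ⟨juxtapose lam (fun j => tensorPower n (m j)) z, by
    have hz := z.2
    rw [mem_ball_zero_iff] at hz ⊢
    have h1 : ∑ j, ‖lam j‖ ^ 2 = 1 := by
      rw [← EuclideanSpace.norm_sq_eq, hlam, one_pow]
    refine (sq_lt_one_iff₀ (norm_nonneg _)).1 ?_
    rw [norm_sq_juxtapose, ← h1]
    obtain ⟨j, hj, hl⟩ := hm
    refine Finset.sum_lt_sum (fun i _ => ?_) ⟨j, Finset.mem_univ _, ?_⟩
    · refine mul_le_of_le_one_right (by positivity) ?_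
      rw [norm_tensorPower]
      exact pow_le_one₀ (by positivity) (pow_le_one₀ (norm_nonneg _) hz.le)
    · refine mul_lt_of_lt_one_right (by positivity) ?_
      rw [norm_tensorPower]
      exact pow_lt_one₀ (by positivity) (pow_lt_one₀ (norm_nonneg _) hz hj) two_ne_zero⟩

/-! Membership in `Γ_f` is a condition on the kernel `1 - ⟪f z, f w⟫` alone. Automorphisms of a ball
multiply `1 - ⟪z, w⟫` by a factor `conj (h z) * h w` (`automorphyRelated_ballAut`, from Cartan's
theorem and the Möbius involutions). Conversely, families of points whose kernels differ by such a
factor differ by an automorphism: move a base point to the centre, and the Gram matrices agree.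
Hence `mem_hermitianGroup_iff`.

For the maps at hand `⟪f z, f w⟫ = Φ ⟪z, w⟫` with `Φ t = ∑ |λ_j|² t ^ m_j` and `Φ 1 = 1`. Unitary
maps preserve this kernel, so `U(n) ≤ Γ_f`; a single block of size `n` then gives source rank at
most 1, and 1 is a lower bound for every group. Properness holds because `‖f z‖² = Φ (‖z‖²)` tends
to 1 at the sphere.

If `g ∈ Γ_f` moves the centre, cross-ratios of the two kernels eliminate the factors and leave `(1 -
Φ ((B - u) / (1 - u))) * (1 - Φ u) = K` for `u ∈ [0, B]`, with `B = ‖g 0‖²`. Clearing denominators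
gives a polynomial with a simple zero at `u = 1` on the left, but a zero of order `d = deg Φ` or the
zero polynomial on the right: impossible for `d ≥ 2`. So `g` fixes the centre and is unitary by
Cartan. For `Φ t = |λ₁|² + |λ₂|² t`, instead, `1 - Φ t = |λ₂|² (1 - t)`, and every automorphism
qualifies. -/

open scoped ComplexConjugate InnerProductSpace

/-! ### Gram matrices, the Schwarz lemma and Cartan's theorem -/

/-- Two families of vectors with the same Gram matrix differ by a unitary map. -/
theorem exists_linearIsometryEquiv_of_inner_eq {X V : Type*} [NormedAddCommGroup V]
    [InnerProductSpace ℂ V] [FiniteDimensional ℂ V] (F G : X → V)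
    (h : ∀ x y, ⟪F x, F y⟫_ℂ = ⟪G x, G y⟫_ℂ) :
    ∃ U : V ≃ₗᵢ[ℂ] V, ∀ x, U (G x) = F x := by
  let LF : (X →₀ ℂ) →ₗ[ℂ] V := Finsupp.linearCombination ℂ F
  let LG : (X →₀ ℂ) →ₗ[ℂ] V := Finsupp.linearCombination ℂ G
  have hnorm : ∀ c, ‖LF c‖ = ‖LG c‖ := fun c => by
    have : ⟪LF c, LF c⟫_ℂ = ⟪LG c, LG c⟫_ℂ := by
      simp only [LF, LG, Finsupp.linearCombination_apply, Finsupp.sum, sum_inner, inner_sum,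
        inner_smul_left, inner_smul_right, h]
    rw [inner_self_eq_norm_sq_to_K, inner_self_eq_norm_sq_to_K] at this
    exact (sq_eq_sq₀ (norm_nonneg _) (norm_nonneg _)).1 (by exact_mod_cast this)
  have hker : LG.ker ≤ LF.ker := fun c hc => by
    rw [LinearMap.mem_ker] at hc ⊢
    rw [← norm_eq_zero, hnorm, hc, norm_zero]
  -- Equal norms make `G x ↦ F x` well defined and isometric on the span of `G`; finite dimension
  -- lets it extend to a unitary map.
  let M : LG.range →ₗ[ℂ] V := LG.ker.liftQ LF hker ∘ₗ LG.quotKerEquivRange.symm.toLinearMap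
  have hM : ∀ c (hc : LG c ∈ LG.range), M ⟨LG c, hc⟩ = LF c := fun c hc => by
    simp [M, LinearMap.quotKerEquivRange_symm_apply_image]
  let L : LG.range →ₗᵢ[ℂ] V := ⟨M, by
    rintro ⟨_, c, rfl⟩
    exact (congrArg norm (hM c _)).trans (hnorm c)⟩
  refine ⟨L.extend.toLinearIsometryEquiv rfl, fun x => ?_⟩
  have hG : LG (Finsupp.single x 1) = G x := by simp [LG]
  have hF : LF (Finsupp.single x 1) = F x := by simp [LF]
  have := L.extend_apply ⟨LG (Finsupp.single x 1), LinearMap.mem_range_self _ _⟩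
  rw [LinearIsometry.toLinearIsometryEquiv_apply, ← hG, this, ← hF]
  exact hM _ _

/-- A linear isometric automorphism of `ℂ^κ`, restricted to the unit ball. -/
noncomputable def isometryAut {κ : Type} [Fintype κ]
    (U : EuclideanSpace ℂ κ ≃ₗᵢ[ℂ] EuclideanSpace ℂ κ) : ballAut κ :=
  ⟨{ toFun := fun z => ⟨U z, by simpa only [mem_ball_zero_iff, U.norm_map] using z.2⟩
     invFun := fun z => ⟨U.symm z, by simpa only [mem_ball_zero_iff, U.symm.norm_map] using z.2⟩
     left_inv := fun z => by simp
     right_inv := fun z => by simp },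
   ⟨U, U.differentiable.differentiableOn, fun _ => rfl⟩,
   ⟨U.symm, U.symm.differentiable.differentiableOn, fun _ => rfl⟩⟩

theorem unitBall_norm_lt {κ : Type} [Fintype κ] (z : unitBall κ) :
    ‖(z : EuclideanSpace ℂ κ)‖ < 1 :=
  mem_ball_zero_iff.1 z.2

/-- The centre of the unit ball. -/
noncomputable def ballCenter (κ : Type) [Fintype κ] : unitBall κ := ⟨0, by simp⟩

/-- A holomorphic self-map of the ball that fixes the centre does not increase norms. -/
theorem IsHolo.norm_le {κ : Type} [Fintype κ] {g : unitBall κ → unitBall κ} (hg : IsHolo g)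
    (h0 : g (ballCenter κ) = ballCenter κ) (z : unitBall κ) :
    ‖(g z : EuclideanSpace ℂ κ)‖ ≤ ‖(z : EuclideanSpace ℂ κ)‖ := by
  obtain ⟨G, hG, hGg⟩ := hg
  rw [← hGg]
  refine Complex.norm_le_norm_of_mapsTo_ball hG (fun w hw => ?_) ?_ (unitBall_norm_lt z)
  · rw [hGg ⟨w, hw⟩]
    exact Metric.ball_subset_closedBall (g ⟨w, hw⟩).2
  · have := hGg (ballCenter κ)
    rw [h0] at this
    exact this

/-- A holomorphic map of the ball into a Euclidean space that preserves norms is linear. -/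
theorem eq_fderiv_of_norm_eq {κ : Type} [Fintype κ]
    {G : EuclideanSpace ℂ κ → EuclideanSpace ℂ κ} (hG : DifferentiableOn ℂ G (unitBall κ))
    (hnorm : ∀ z ∈ unitBall κ, ‖G z‖ = ‖z‖) {z : EuclideanSpace ℂ κ} (hz : z ∈ unitBall κ) :
    G z = fderiv ℂ G 0 z := by
  have h0 : G 0 = 0 := norm_eq_zero.1 (by rw [hnorm 0 (by simp), norm_zero])
  rcases eq_or_ne z 0 with rfl | hz0
  · rw [h0, map_zero]
  have hzn : ‖z‖ ≠ 0 := norm_ne_zero_iff.2 hz0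
  have hz1 : ‖z‖ < 1 := mem_ball_zero_iff.1 hz
  let e : EuclideanSpace ℂ κ := ((‖z‖ : ℂ)⁻¹) • z
  have he : ‖e‖ = 1 := by simp [e, norm_smul, hzn]
  have hze : (‖z‖ : ℂ) • e = z := by
    simp [e, smul_smul, hzn]
  have hmem : ∀ t ∈ Metric.ball (0 : ℂ) 1, t • e ∈ unitBall κ := fun t ht => by
    simpa [norm_smul, he] using ht
  -- Restricted to the complex line through `z`, `‖f t‖ = ‖t‖` is the equality case of the Schwarz
  -- lemma, so `f` is affine; its slope is then the derivative of `G` at 0 along `e`.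
  let f : ℂ → EuclideanSpace ℂ κ := fun t => G (t • e)
  have hf0 : f 0 = 0 := by simp [f, h0]
  have hfd : DifferentiableOn ℂ f (Metric.ball 0 1) :=
    hG.comp (by fun_prop) hmem
  have hmaps : Set.MapsTo f (Metric.ball 0 1) (Metric.closedBall (f 0) 1) := fun t ht => by
    have h1 := hnorm _ (hmem t ht)
    rw [norm_smul, he, mul_one] at h1
    rw [hf0, mem_closedBall_zero_iff]
    exact h1.trans_le (mem_ball_zero_iff.1 ht).le
  have hzb : (‖z‖ : ℂ) ∈ Metric.ball (0 : ℂ) 1 := by simpa using hz1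
  obtain ⟨C, -, hC⟩ := Complex.affine_of_mapsTo_ball_of_exists_norm_dslope_eq_div' hfd hmaps
    ⟨(‖z‖ : ℂ), hzb, by
      rw [dslope_of_ne _ (by simpa using hz0), slope_def_module, hf0]
      simp [f, hze, norm_smul, hnorm z hz, hzn]⟩
  have hCd : HasDerivAt f C 0 := by
    have h1 : HasDerivAt (fun t : ℂ => f 0 + (t - 0) • C) C 0 := by
      simpa using (((hasDerivAt_id (0 : ℂ)).sub_const 0).smul_const C).const_add (f 0)
    exact h1.congr_of_eventuallyEq (Filter.eventuallyEq_of_mem (Metric.ball_mem_nhds _ one_pos) hC)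
  have hGd : HasFDerivAt G (fderiv ℂ G 0) ((0 : ℂ) • e) := by
    rw [zero_smul]
    exact (hG.differentiableAt (Metric.ball_mem_nhds _ one_pos)).hasFDerivAt
  have hfd' : HasDerivAt f (fderiv ℂ G 0 e) 0 := by
    have h2 : HasDerivAt (fun t : ℂ => t • e) e 0 := by
      simpa using (hasDerivAt_id (0 : ℂ)).smul_const e
    exact hGd.comp_hasDerivAt (0 : ℂ) h2
  have h3 := hC hzb
  simp only [hf0, sub_zero, zero_add, f, hze] at h3
  rw [h3, hCd.unique hfd', ← map_smul, hze]

/-- **Cartan's theorem** for the ball: an automorphism fixing the centre is unitary. -/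
theorem exists_linearIsometryEquiv_of_map_center {κ : Type} [Fintype κ] (g : ballAut κ)
    (h0 : g.1 (ballCenter κ) = ballCenter κ) :
    ∃ U : EuclideanSpace ℂ κ ≃ₗᵢ[ℂ] EuclideanSpace ℂ κ,
      ∀ z : unitBall κ, (g.1 z : EuclideanSpace ℂ κ) = U z := by
  obtain ⟨hg, hg'⟩ := g.2
  have h0' : g.1.symm (ballCenter κ) = ballCenter κ := by
    rw [Equiv.symm_apply_eq, h0]
  have hn : ∀ z : unitBall κ, ‖(g.1 z : EuclideanSpace ℂ κ)‖ = ‖(z : EuclideanSpace ℂ κ)‖ :=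
    fun z => le_antisymm (hg.norm_le h0 z) (by simpa using hg'.norm_le h0' (g.1 z))
  obtain ⟨G, hG, hGg⟩ := hg
  have hlin : ∀ z ∈ unitBall κ, G z = fderiv ℂ G 0 z := fun z hz =>
    eq_fderiv_of_norm_eq hG (fun w hw => by rw [hGg ⟨w, hw⟩, hn ⟨w, hw⟩]) hz
  let L : EuclideanSpace ℂ κ →ₗᵢ[ℂ] EuclideanSpace ℂ κ := ⟨(fderiv ℂ G 0).toLinearMap, fun z => by
    -- Linearity and norm preservation are known only inside the ball; this factor scales any `z`
    -- into it.
    let c : ℂ := ((1 + ‖z‖ : ℝ) : ℂ)⁻¹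
    have hp : (0 : ℝ) < 1 + ‖z‖ := by positivity
    have hc : ‖c‖ = (1 + ‖z‖)⁻¹ := by
      rw [norm_inv, Complex.norm_real, Real.norm_of_nonneg hp.le]
    have hcz : c • z ∈ unitBall κ := by
      rw [mem_ball_zero_iff, norm_smul, hc, inv_mul_lt_iff₀ hp]
      linarith
    have h1 : ‖fderiv ℂ G 0 (c • z)‖ = ‖c • z‖ := by
      rw [← hlin _ hcz, hGg ⟨_, hcz⟩, hn ⟨_, hcz⟩]
    rw [map_smul, norm_smul, norm_smul] at h1
    exact mul_left_cancel₀ (by rw [hc]; positivity) h1⟩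
  refine ⟨L.toLinearIsometryEquiv rfl, fun z => ?_⟩
  rw [LinearIsometry.toLinearIsometryEquiv_apply, ← hGg, hlin z z.2]
  rfl

/-! ### Möbius involutions of the ball -/

section Mobius

variable {κ : Type} [Fintype κ]

theorem norm_inner_lt_one (z w : unitBall κ) :
    ‖⟪(z : EuclideanSpace ℂ κ), (w : EuclideanSpace ℂ κ)⟫_ℂ‖ < 1 :=
  (norm_inner_le_norm _ _).trans_lt
    (mul_lt_one_of_nonneg_of_lt_one_left (norm_nonneg _) (unitBall_norm_lt z)
      (unitBall_norm_lt w).le)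

theorem one_sub_inner_ne_zero (z w : unitBall κ) :
    1 - ⟪(z : EuclideanSpace ℂ κ), (w : EuclideanSpace ℂ κ)⟫_ℂ ≠ 0 := fun h => by
  have := norm_inner_lt_one z w
  rw [← sub_eq_zero.1 h, norm_one] at this
  exact this.false

/-- The number `√(1 - ‖a‖²)`. -/
noncomputable def mobiusScale (a : unitBall κ) : ℝ :=
  √(1 - ‖(a : EuclideanSpace ℂ κ)‖ ^ 2)

theorem mobiusScale_pos (a : unitBall κ) : 0 < mobiusScale a := by
  refine Real.sqrt_pos.2 (sub_pos.2 ?_)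
  exact pow_lt_one₀ (norm_nonneg _) (unitBall_norm_lt a) two_ne_zero

/-- With `s = mobiusScale a`, `‖a‖² = (1 - s) * (1 + s)`. This is why the projection onto `a` enters
`mobiusFun` with denominator `1 + s` instead of `‖a‖²`, so that `a = 0` is no special case. -/
theorem inner_self_eq_one_sub_mobiusScale_sq (a : unitBall κ) :
    ⟪(a : EuclideanSpace ℂ κ), (a : EuclideanSpace ℂ κ)⟫_ℂ = 1 - (mobiusScale a : ℂ) ^ 2 := by
  have h : mobiusScale a ^ 2 = 1 - ‖(a : EuclideanSpace ℂ κ)‖ ^ 2 :=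
    Real.sq_sqrt (sub_nonneg.2 (pow_le_one₀ (norm_nonneg _) (unitBall_norm_lt a).le))
  rw [← Complex.ofReal_pow, h, inner_self_eq_norm_sq_to_K]
  simp

theorem one_add_mobiusScale_ne_zero (a : unitBall κ) : (1 + mobiusScale a : ℂ) ≠ 0 := by
  have := mobiusScale_pos a
  exact_mod_cast (by positivity : (1 + mobiusScale a : ℝ) ≠ 0)

theorem mobiusScale_ne_zero (a : unitBall κ) : (mobiusScale a : ℂ) ≠ 0 :=
  Complex.ofReal_ne_zero.2 (mobiusScale_pos a).ne'

/-- The Möbius involution of the ball that interchanges `a` and the centre. -/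
noncomputable def mobiusFun (a : unitBall κ) (z : EuclideanSpace ℂ κ) : EuclideanSpace ℂ κ :=
  (1 - ⟪(a : EuclideanSpace ℂ κ), z⟫_ℂ)⁻¹ •
    ((1 - ⟪(a : EuclideanSpace ℂ κ), z⟫_ℂ / (1 + mobiusScale a)) • (a : EuclideanSpace ℂ κ) -
      (mobiusScale a : ℂ) • z)

theorem one_sub_inner_mobiusFun (a z w : unitBall κ) :
    1 - ⟪mobiusFun a z, mobiusFun a w⟫_ℂ =
      conj (mobiusScale a / (1 - ⟪(a : EuclideanSpace ℂ κ), (z : EuclideanSpace ℂ κ)⟫_ℂ)) *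
        (mobiusScale a / (1 - ⟪(a : EuclideanSpace ℂ κ), (w : EuclideanSpace ℂ κ)⟫_ℂ)) *
        (1 - ⟪(z : EuclideanSpace ℂ κ), (w : EuclideanSpace ℂ κ)⟫_ℂ) := by
  have hs := one_add_mobiusScale_ne_zero a
  have hz := one_sub_inner_ne_zero z a
  have hw := one_sub_inner_ne_zero a w
  have hN := inner_self_eq_one_sub_mobiusScale_sq a
  simp only [mobiusFun, inner_smul_left, inner_smul_right, inner_sub_left, inner_sub_right,
    map_div₀, map_sub, map_one, map_inv₀, map_add, Complex.conj_ofReal, inner_conj_symm, hN]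
  generalize ⟪(z : EuclideanSpace ℂ κ), (a : EuclideanSpace ℂ κ)⟫_ℂ = c at *
  generalize ⟪(a : EuclideanSpace ℂ κ), (w : EuclideanSpace ℂ κ)⟫_ℂ = d at *
  field_simp
  ring

theorem norm_lt_one_of_one_sub_inner_eq {v : EuclideanSpace ℂ κ} {z : unitBall κ} {c : ℂ}
    (hc : c ≠ 0) (h : 1 - ⟪v, v⟫_ℂ =
      conj c * c * (1 - ⟪(z : EuclideanSpace ℂ κ), (z : EuclideanSpace ℂ κ)⟫_ℂ)) : ‖v‖ < 1 := by
  rw [inner_self_eq_norm_sq_to_K, inner_self_eq_norm_sq_to_K, mul_comm (conj c),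
    Complex.mul_conj] at h
  have h' : 1 - ‖v‖ ^ 2 = Complex.normSq c * (1 - ‖(z : EuclideanSpace ℂ κ)‖ ^ 2) := by
    refine Complex.ofReal_injective ?_
    simpa using h
  have h1 : 0 < Complex.normSq c * (1 - ‖(z : EuclideanSpace ℂ κ)‖ ^ 2) :=
    mul_pos (Complex.normSq_pos.2 hc)
      (sub_pos.2 (pow_lt_one₀ (norm_nonneg _) (unitBall_norm_lt z) two_ne_zero))
  rw [← h', sub_pos] at h1
  exact (sq_lt_one_iff₀ (norm_nonneg _)).1 h1

theorem mobiusFun_mem (a z : unitBall κ) : mobiusFun a z ∈ unitBall κ :=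
  mem_ball_zero_iff.2 <| norm_lt_one_of_one_sub_inner_eq
    (div_ne_zero (mobiusScale_ne_zero a) (one_sub_inner_ne_zero a z))
    (one_sub_inner_mobiusFun a z z)

theorem mobiusFun_mobiusFun (a z : unitBall κ) :
    mobiusFun a (mobiusFun a z) = (z : EuclideanSpace ℂ κ) := by
  have hs := one_add_mobiusScale_ne_zero a
  have hs0 := mobiusScale_ne_zero a
  have hz := one_sub_inner_ne_zero a z
  have hN := inner_self_eq_one_sub_mobiusScale_sq a
  have h1 : ⟪(a : EuclideanSpace ℂ κ), mobiusFun a z⟫_ℂ =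
      1 - (mobiusScale a : ℂ) ^ 2 /
        (1 - ⟪(a : EuclideanSpace ℂ κ), (z : EuclideanSpace ℂ κ)⟫_ℂ) := by
    simp only [mobiusFun, inner_smul_right, inner_sub_right, hN]
    generalize ⟪(a : EuclideanSpace ℂ κ), (z : EuclideanSpace ℂ κ)⟫_ℂ = c at *
    field_simp
    ring
  rw [mobiusFun, h1, mobiusFun]
  generalize ⟪(a : EuclideanSpace ℂ κ), (z : EuclideanSpace ℂ κ)⟫_ℂ = c at *
  generalize (mobiusScale a : ℂ) = s at *
  match_scalars
  · field_simp
    ring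
  · field_simp
    ring

theorem isHolo_mobiusFun (a : unitBall κ) :
    IsHolo (fun z : unitBall κ => (⟨mobiusFun a z, mobiusFun_mem a z⟩ : unitBall κ)) := by
  refine ⟨mobiusFun a, fun z hz => DifferentiableAt.differentiableWithinAt ?_, fun _ => rfl⟩
  have hz' := one_sub_inner_ne_zero a ⟨z, hz⟩
  have hd : DifferentiableAt ℂ (fun w => ⟪(a : EuclideanSpace ℂ κ), w⟫_ℂ) z :=
    (innerSL ℂ (a : EuclideanSpace ℂ κ)).differentiableAt
  have hs : DifferentiableAt ℂ (fun w : EuclideanSpace ℂ κ => (mobiusScale a : ℂ) • w) z := by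
    fun_prop
  unfold mobiusFun
  simp only [div_eq_mul_inv]
  exact ((hd.const_sub 1).inv hz').smul
    ((((hd.mul_const _).const_sub 1).smul_const _).sub hs)

/-- The Möbius involution `mobiusFun a` as an automorphism of the ball. -/
noncomputable def mobiusAut (a : unitBall κ) : ballAut κ :=
  ⟨{ toFun := fun z => ⟨mobiusFun a z, mobiusFun_mem a z⟩
     invFun := fun z => ⟨mobiusFun a z, mobiusFun_mem a z⟩
     left_inv := fun z => Subtype.ext (mobiusFun_mobiusFun a z)
     right_inv := fun z => Subtype.ext (mobiusFun_mobiusFun a z) },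
   isHolo_mobiusFun a, isHolo_mobiusFun a⟩

theorem mobiusAut_self (a : unitBall κ) : (mobiusAut a).1 a = ballCenter κ := by
  have hs := one_add_mobiusScale_ne_zero a
  refine Subtype.ext ?_
  change mobiusFun a a = 0
  rw [mobiusFun, inner_self_eq_one_sub_mobiusScale_sq, ← sub_smul,
    show (1 - (1 - (mobiusScale a : ℂ) ^ 2) / (1 + mobiusScale a) - mobiusScale a : ℂ) = 0 by
      field_simp
      ring, zero_smul, smul_zero]

end Mobius

/-! ### Kernels up to an automorphy factor -/

section AutomorphyRelated

variable {X κ : Type} [Fintype κ]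

/-- Two families of points in the ball are related by an automorphy factor `h` if
`1 - ⟪F x, F y⟫ = conj (h x) * h y * (1 - ⟪G x, G y⟫)`. -/
def AutomorphyRelated (F G : X → unitBall κ) : Prop :=
  ∃ h : X → ℂ, ∀ x y, 1 - ⟪(F x : EuclideanSpace ℂ κ), (F y : EuclideanSpace ℂ κ)⟫_ℂ =
    conj (h x) * h y * (1 - ⟪(G x : EuclideanSpace ℂ κ), (G y : EuclideanSpace ℂ κ)⟫_ℂ)

theorem AutomorphyRelated.trans {F G H : X → unitBall κ} (h1 : AutomorphyRelated F G)
    (h2 : AutomorphyRelated G H) : AutomorphyRelated F H := by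
  obtain ⟨a, ha⟩ := h1
  obtain ⟨b, hb⟩ := h2
  refine ⟨fun x => a x * b x, fun x y => ?_⟩
  rw [ha, hb, map_mul]
  ring

theorem AutomorphyRelated.symm {F G : X → unitBall κ} (h : AutomorphyRelated F G) :
    AutomorphyRelated G F := by
  obtain ⟨a, ha⟩ := h
  have ha0 : ∀ x, a x ≠ 0 := fun x h0 => one_sub_inner_ne_zero (F x) (F x) (by
    rw [ha, h0, mul_zero, zero_mul])
  refine ⟨fun x => (a x)⁻¹, fun x y => ?_⟩
  have h1 := ha0 y
  have h2 : conj (a x) ≠ 0 := (map_ne_zero _).2 (ha0 x)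
  rw [ha, map_inv₀]
  field_simp

theorem automorphyRelated_of_inner_eq {F G : X → unitBall κ}
    (h : ∀ x y, ⟪(F x : EuclideanSpace ℂ κ), (F y : EuclideanSpace ℂ κ)⟫_ℂ =
      ⟪(G x : EuclideanSpace ℂ κ), (G y : EuclideanSpace ℂ κ)⟫_ℂ) : AutomorphyRelated F G :=
  ⟨fun _ => 1, fun x y => by rw [h, map_one, one_mul, one_mul]⟩

theorem automorphyRelated_mobiusAut (a : unitBall κ) (F : X → unitBall κ) :
    AutomorphyRelated (fun x => (mobiusAut a).1 (F x)) F :=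
  ⟨_, fun x y => one_sub_inner_mobiusFun a (F x) (F y)⟩

/-- Automorphisms of the ball transform the kernel `1 - ⟪z, w⟫` by an automorphy factor. -/
theorem automorphyRelated_ballAut (g : ballAut κ) (F : X → unitBall κ) :
    AutomorphyRelated (fun x => g.1 (F x)) F := by
  obtain ⟨U, hU⟩ := exists_linearIsometryEquiv_of_map_center
    -- Following `g` by the involution at the image of the centre fixes the centre, so Cartan's
    -- theorem applies.
    (mobiusAut (g.1 (ballCenter κ)) * g)
    (by rw [Subgroup.coe_mul, Equiv.Perm.mul_apply, mobiusAut_self])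
  have h1 : AutomorphyRelated
      (fun x => (mobiusAut (g.1 (ballCenter κ))).1 (g.1 (F x))) F :=
    automorphyRelated_of_inner_eq fun x y => by
      have hx := hU (F x)
      have hy := hU (F y)
      simp only [Subgroup.coe_mul, Equiv.Perm.mul_apply] at hx hy
      rw [hx, hy, U.inner_map_map]
  exact (automorphyRelated_mobiusAut _ _).symm.trans h1

/-- Families of points in the ball with proportional kernels differ by an automorphism. -/
theorem AutomorphyRelated.exists_ballAut {F G : X → unitBall κ} (h : AutomorphyRelated F G) :
    ∃ g : ballAut κ, ∀ x, F x = g.1 (G x) := by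
  rcases isEmpty_or_nonempty X with hX | ⟨⟨x₀⟩⟩
  · exact ⟨1, fun x => isEmptyElim x⟩
  obtain ⟨a, ha⟩ := ((automorphyRelated_mobiusAut (F x₀) F).trans h).trans
    (automorphyRelated_mobiusAut (G x₀) G).symm
  have hF := congrArg Subtype.val (mobiusAut_self (F x₀))
  have hG := congrArg Subtype.val (mobiusAut_self (G x₀))
  -- After normalization both families are 0 at `x₀`, so both kernels equal 1 there. This forces the
  -- factor to be a unimodular constant, and the Gram matrices coincide.
  have h0 : ∀ y, conj (a x₀) * a y = 1 := fun y => by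
    have := ha x₀ y
    rw [hF, hG] at this
    simpa [ballCenter] using this.symm
  have hconst : ∀ y, a y = a x₀ := fun y =>
    mul_left_cancel₀ (left_ne_zero_of_mul_eq_one (h0 y)) ((h0 y).trans (h0 x₀).symm)
  obtain ⟨U, hU⟩ := exists_linearIsometryEquiv_of_inner_eq
    (fun x => ((mobiusAut (F x₀)).1 (F x) : EuclideanSpace ℂ κ))
    (fun x => ((mobiusAut (G x₀)).1 (G x) : EuclideanSpace ℂ κ)) (fun x y => by
      have := ha x y
      rw [hconst x, h0, one_mul] at this
      exact sub_right_injective this)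
  refine ⟨(mobiusAut (F x₀))⁻¹ * isometryAut U * mobiusAut (G x₀), fun x => ?_⟩
  simp only [Subgroup.coe_mul, Equiv.Perm.mul_apply, Subgroup.coe_inv]
  rw [eq_comm, Equiv.Perm.inv_eq_iff_eq]
  exact Subtype.ext (hU x)

theorem mem_hermitianGroup_iff {ι : Type} [Fintype ι] {f : unitBall ι → unitBall κ}
    {g : ballAut ι} :
    g ∈ hermitianGroup f ↔ AutomorphyRelated (fun z => f (g.1 z)) f := by
  refine ⟨fun ⟨p, hp⟩ => ?_, fun h => h.exists_ballAut⟩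
  have : (fun z => f (g.1 z)) = fun z => p.1 (f z) := funext hp
  rw [this]
  exact automorphyRelated_ballAut p f

end AutomorphyRelated

/-! ### Source rank of maps with unitary symmetry -/

section SourceRank

/-- The empty family shows that `blockValues` is never empty; otherwise `sInf ∅ = 0` would spoil the
lower bound on the rank. -/
theorem blockUnitary_of_isEmpty {n : ℕ} (k : Fin 0 → ℕ) : blockUnitary n k = ⊥ := by
  refine (Subgroup.eq_bot_iff_forall _).2 fun U hU => ?_
  have h : U.toLinearEquiv.toLinearMap = LinearMap.id := by
    refine (EuclideanSpace.basisFun (Fin n) ℂ).toBasis.ext fun i => ?_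
    ext i'
    have := hU i' i fun ⟨j, _⟩ => j.elim0
    simpa [unitaryEntry, Pi.single_apply] using this
  exact LinearIsometryEquiv.ext fun z => LinearMap.congr_fun h z

theorem one_le_of_mem_blockValues {n : ℕ} (hn : 1 ≤ n) {Γ : Subgroup (ballAut (Fin n))} {s : ℕ}
    (hs : s ∈ blockValues Γ) : 1 ≤ s := by
  obtain ⟨J, k, hk, -, rfl⟩ := hs
  by_cases h : ∃ j, k j ≠ 0
  · obtain ⟨j, hj⟩ := h
    have : ∑ j, (k j - 1) < ∑ j, k j :=
      Finset.sum_lt_sum (fun i _ => Nat.sub_le _ _) ⟨j, Finset.mem_univ _, by omega⟩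
    omega
  · push Not at h
    simpa [h] using hn

theorem one_le_rankOfGroup {n : ℕ} (hn : 1 ≤ n) (Γ : Subgroup (ballAut (Fin n))) :
    1 ≤ rankOfGroup Γ := by
  refine one_le_of_mem_blockValues hn (Nat.sInf_mem ⟨n, 0, Fin.elim0, by simp, ?_, by simp⟩)
  rw [blockUnitary_of_isEmpty, Subgroup.map_bot]
  exact bot_le

theorem rankOfGroup_le_one {n : ℕ} (hn : 1 ≤ n) {Γ : Subgroup (ballAut (Fin n))}
    (hΓ : unitaryAut n ≤ Γ) : rankOfGroup Γ ≤ 1 := by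
  refine Nat.sInf_le ⟨1, fun _ => n, by simp, ?_, ?_⟩
  · rintro _ ⟨U, -, rfl⟩
    exact hΓ ⟨U, rfl⟩
  · simp only [Finset.univ_unique, Finset.sum_singleton]
    omega

theorem sourceRank_eq_one {n : ℕ} (hn : 1 ≤ n) {κ : Type} [Fintype κ]
    {f : unitBall (Fin n) → unitBall κ} (hf : unitaryAut n ≤ hermitianGroup f) :
    sourceRank f = 1 := by
  -- The value 1 is attained at `γ = 1`.
  refine le_antisymm ((ciInf_le' _ 1).trans (rankOfGroup_le_one hn ?_))
    (le_ciInf fun γ => one_le_rankOfGroup hn _)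
  refine hf.trans fun g hg => ⟨g, hg, ?_⟩
  simp

end SourceRank

/-! ### Excluding the functional equation by the order of vanishing at 1 -/

section Polynomial

open Polynomial

/-- A convex combination `Φ` of monomials, one of them of degree at least `2`, does not satisfy
`(1 - Φ ((A - u) / (1 - u))) * (1 - Φ u) = K` on an interval. -/
theorem not_forall_one_sub_mul_one_sub_eq {k : ℕ} {c : Fin k → ℝ} {m : Fin k → ℕ}
    (hc : ∀ j, 0 ≤ c j) (hsum : ∑ j, c j = 1) (hm : ∃ j, 2 ≤ m j ∧ c j ≠ 0) {A K : ℝ}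
    (hA0 : 0 < A) (hA1 : A < 1)
    (h : ∀ u ∈ Set.Icc 0 A,
      (1 - ∑ j, c j * ((A - u) / (1 - u)) ^ m j) * (1 - ∑ j, c j * u ^ m j) = K) : False := by
  obtain ⟨i, hi2, hic⟩ := hm
  obtain ⟨l, hl, hmax⟩ := (Finset.univ.filter fun j => c j ≠ 0).exists_max_image m
    ⟨i, by simpa using hic⟩
  have hlc : c l ≠ 0 := (Finset.mem_filter.1 hl).2
  have hle : ∀ j, c j ≠ 0 → m j ≤ m l := fun j hj => hmax j (by simpa using hj)
  have hd : 2 ≤ m l := hi2.trans (hle i hic)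
  generalize hdef : m l = d at hle hd
  -- `P` is the first factor multiplied by `(1 - u) ^ d`, where `d` is the top degree among the
  -- nonzero coefficients; `Q` is the second factor.
  let P : ℝ[X] := (1 - X) ^ d - ∑ j, C (c j) * ((C A - X) ^ m j * (1 - X) ^ (d - m j))
  let Q : ℝ[X] := 1 - ∑ j, C (c j) * X ^ m j
  have hPQ : P * Q = C K * (1 - X) ^ d := by
    refine eq_of_infinite_eval_eq _ _ ((Set.Icc_infinite hA0).mono fun u hu => ?_)
    have hu1 : (1 : ℝ) - u ≠ 0 := (sub_pos.2 (hu.2.trans_lt hA1)).ne'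
    have hP : P.eval u = (1 - u) ^ d * (1 - ∑ j, c j * ((A - u) / (1 - u)) ^ m j) := by
      simp only [P, eval_sub, eval_pow, eval_one, eval_X, eval_finsetSum, eval_mul, eval_C]
      rw [mul_sub, mul_one, Finset.mul_sum]
      congr 1
      refine Finset.sum_congr rfl fun j _ => ?_
      -- A term with zero coefficient may have `m j > d`, where `d - m j` truncates.
      rcases eq_or_ne (c j) 0 with h0 | h0
      · simp [h0]
      · rw [← Nat.sub_add_cancel (hle j h0), pow_add, Nat.sub_add_cancel (hle j h0), div_pow]
        field_simp
    have hQ : Q.eval u = 1 - ∑ j, c j * u ^ m j := by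
      simp [Q, eval_finsetSum]
    simp only [Set.mem_ofPred_eq, eval_mul, eval_C, eval_pow, eval_sub, eval_one, eval_X]
    rw [hP, hQ, mul_assoc, h u hu, mul_comm]
  have hQ1 : Q.eval 1 = 0 := by simp [Q, eval_finsetSum, hsum]
  have hQ1' : Q.derivative.eval 1 < 0 := by
    have : Q.derivative.eval 1 = -∑ j, c j * m j := by
      simp [Q, eval_finsetSum, derivative_X_pow]
    rw [this, neg_lt_zero]
    refine Finset.sum_pos' (fun j _ => mul_nonneg (hc j) (Nat.cast_nonneg _))
      ⟨l, Finset.mem_univ _, mul_pos ((hc l).lt_of_ne' hlc) ?_⟩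
    exact_mod_cast (by omega : 0 < m l)
  -- At 1 only the terms with `m j = d` survive, each contributing `-c j * (A - 1) ^ d`.
  have hP1 : P.eval 1 ≠ 0 := by
    have h1 : P.eval 1 = -((A - 1) ^ d * ∑ j, c j * 0 ^ (d - m j)) := by
      simp only [P, eval_sub, eval_pow, eval_one, eval_X, eval_finsetSum, eval_mul, eval_C,
        sub_self, zero_pow (by omega : d ≠ 0), zero_sub]
      rw [Finset.mul_sum]
      congr 1
      refine Finset.sum_congr rfl fun j _ => ?_
      rcases eq_or_ne (c j) 0 with h0 | h0
      · simp [h0]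
      · rcases (hle j h0).eq_or_lt with h2 | h2
        · rw [h2]
          ring
        · simp [zero_pow (Nat.sub_pos_of_lt h2).ne']
    rw [h1, neg_ne_zero]
    refine mul_ne_zero (pow_ne_zero _ (sub_neg.2 hA1).ne) (ne_of_gt ?_)
    refine Finset.sum_pos' (fun j _ => mul_nonneg (hc j) (by positivity))
      ⟨l, Finset.mem_univ _, ?_⟩
    simpa [hdef] using (hc l).lt_of_ne' hlc
  -- Differentiating at 1 leaves `P 1 * Q' 1` on the left, and 0 on the right because `d ≥ 2`.
  have hder := congrArg (fun p => p.derivative.eval 1) hPQ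
  simp only [derivative_mul, eval_add, eval_mul, hQ1, mul_zero, zero_add, derivative_C, zero_mul,
    eval_C, derivative_pow, derivative_sub, derivative_one, derivative_X, eval_zero, eval_pow,
    eval_sub, eval_one, eval_X, sub_self, zero_pow (by omega : d - 1 ≠ 0)] at hder
  exact mul_ne_zero hP1 hQ1'.ne hder

end Polynomial

/-! ### Maps whose kernel is a function of the inner product -/

section MonomialKernel

variable {κ : Type} [Fintype κ]

/-- Each side collects the same four values of the automorphy factor, so the unknown factor drops
out. -/
theorem AutomorphyRelated.crossRatio {X : Type} {F G : X → unitBall κ}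
    (h : AutomorphyRelated F G) (x y p q : X) :
    (1 - ⟪(F x : EuclideanSpace ℂ κ), (F y : EuclideanSpace ℂ κ)⟫_ℂ) *
      (1 - ⟪(F p : EuclideanSpace ℂ κ), (F q : EuclideanSpace ℂ κ)⟫_ℂ) *
      ((1 - ⟪(G x : EuclideanSpace ℂ κ), (G q : EuclideanSpace ℂ κ)⟫_ℂ) *
      (1 - ⟪(G p : EuclideanSpace ℂ κ), (G y : EuclideanSpace ℂ κ)⟫_ℂ)) =
    (1 - ⟪(F x : EuclideanSpace ℂ κ), (F q : EuclideanSpace ℂ κ)⟫_ℂ) *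
      (1 - ⟪(F p : EuclideanSpace ℂ κ), (F y : EuclideanSpace ℂ κ)⟫_ℂ) *
      ((1 - ⟪(G x : EuclideanSpace ℂ κ), (G y : EuclideanSpace ℂ κ)⟫_ℂ) *
      (1 - ⟪(G p : EuclideanSpace ℂ κ), (G q : EuclideanSpace ℂ κ)⟫_ℂ)) := by
  obtain ⟨a, ha⟩ := h
  rw [ha x y, ha p q, ha x q, ha p y]
  ring

variable {n k : ℕ} {c : Fin k → ℝ} {m : Fin k → ℕ} {f : unitBall (Fin n) → unitBall κ}

/-- The map `f` between balls satisfies `⟪f z, f w⟫ = ∑ j, c j * ⟪z, w⟫ ^ m j`. -/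
def HasMonomialKernel (c : Fin k → ℝ) (m : Fin k → ℕ) (f : unitBall (Fin n) → unitBall κ) :
    Prop :=
  ∀ z w, ⟪(f z : EuclideanSpace ℂ κ), (f w : EuclideanSpace ℂ κ)⟫_ℂ =
    ∑ j, (c j : ℂ) * ⟪(z : EuclideanSpace ℂ (Fin n)), (w : EuclideanSpace ℂ (Fin n))⟫_ℂ ^ m j

theorem HasMonomialKernel.unitaryAut_le (hf : HasMonomialKernel c m f) :
    unitaryAut n ≤ hermitianGroup f := by
  rintro _ ⟨U, rfl⟩
  refine mem_hermitianGroup_iff.2 (automorphyRelated_of_inner_eq fun z w => ?_)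
  rw [hf, hf]
  exact Finset.sum_congr rfl fun j _ => by
    rw [← U.inner_map_map (z : EuclideanSpace ℂ (Fin n)) w]
    rfl

theorem HasMonomialKernel.map_center (hf : HasMonomialKernel c m f) (hc : ∀ j, 0 ≤ c j)
    (hsum : ∑ j, c j = 1) (hm : ∃ j, 2 ≤ m j ∧ c j ≠ 0) {g : ballAut (Fin n)}
    (hg : g ∈ hermitianGroup f) : g.1 (ballCenter (Fin n)) = ballCenter (Fin n) := by
  by_contra hne
  obtain ⟨o, ho⟩ : ∃ o, o = ballCenter (Fin n) := ⟨_, rfl⟩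
  have hov : (o : EuclideanSpace ℂ (Fin n)) = 0 := by rw [ho]; rfl
  obtain ⟨b, hb⟩ : ∃ b, b = g.1 o := ⟨_, rfl⟩
  obtain ⟨a, ha⟩ : ∃ a, g.1 a = o := ⟨g.1.symm o, g.1.apply_symm_apply o⟩
  have hb0 : (b : EuclideanSpace ℂ (Fin n)) ≠ 0 := fun h =>
    hne (by rw [← ho, ← hb]; exact Subtype.ext (h.trans hov.symm))
  let B : ℝ := ‖(b : EuclideanSpace ℂ (Fin n))‖ ^ 2
  have hB : ⟪(b : EuclideanSpace ℂ (Fin n)), (b : EuclideanSpace ℂ (Fin n))⟫_ℂ = (B : ℂ) := by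
    rw [inner_self_eq_norm_sq_to_K]
    simp [B]
  have hB0 : 0 < B := by positivity
  have hB1 : B < 1 := pow_lt_one₀ (norm_nonneg _) (unitBall_norm_lt b) two_ne_zero
  -- The cross-ratio at `0, z, a, 0`, where `g a = 0` and `g 0 = b`, turns all but three of the
  -- inner products into 0.
  have hself : ∀ z : unitBall (Fin n),
      (1 - ⟪(b : EuclideanSpace ℂ (Fin n)), (g.1 z : EuclideanSpace ℂ (Fin n))⟫_ℂ) *
        (1 - ⟪(a : EuclideanSpace ℂ (Fin n)), (z : EuclideanSpace ℂ (Fin n))⟫_ℂ) = 1 - B :=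
      fun z => by
    have := (automorphyRelated_ballAut g id).crossRatio o z a o
    simpa [ha, hov, ← hb, B] using this
  have haB : ⟪(a : EuclideanSpace ℂ (Fin n)), (a : EuclideanSpace ℂ (Fin n))⟫_ℂ = (B : ℂ) := by
    have := hself a
    rw [ha, hov, inner_zero_right, sub_zero, one_mul] at this
    exact sub_right_injective this
  let Φ : ℂ → ℂ := fun t => ∑ j, (c j : ℂ) * t ^ m j
  have hΦ0 : 1 - Φ 0 ≠ 0 := by
    have := one_sub_inner_ne_zero (f o) (f o)
    rwa [hf, hov, inner_zero_right] at this
  have hker : ∀ z : unitBall (Fin n),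
      (1 - Φ ⟪(b : EuclideanSpace ℂ (Fin n)), (g.1 z : EuclideanSpace ℂ (Fin n))⟫_ℂ) *
        (1 - Φ ⟪(a : EuclideanSpace ℂ (Fin n)), (z : EuclideanSpace ℂ (Fin n))⟫_ℂ) =
        (1 - Φ B) * (1 - Φ 0) := fun z => by
    have := (mem_hermitianGroup_iff.1 hg).crossRatio o z a o
    simp only [hf _ _, ha, hov, ← hb, hB, inner_zero_left, inner_zero_right] at this
    -- Here a zero inner product contributes `1 - Φ 0` rather than 1; two such factors cancel and
    -- one remains on the right.
    refine mul_right_cancel₀ (mul_ne_zero hΦ0 hΦ0) ?_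
    linear_combination this
  refine not_forall_one_sub_mul_one_sub_eq hc hsum hm hB0 hB1
    (K := (1 - ∑ j, c j * B ^ m j) * (1 - ∑ j, c j * 0 ^ m j)) fun u hu => ?_
  have hu1 : u < 1 := hu.2.trans_lt hB1
  -- Since `⟪a, a⟫ = B`, the point `(u / B) • a` has inner product `u` with `a`; it lies in the ball
  -- because `u ≤ B`.
  have hz : ((u / B : ℝ) : ℂ) • (a : EuclideanSpace ℂ (Fin n)) ∈ unitBall (Fin n) := by
    rw [mem_ball_zero_iff, norm_smul, Complex.norm_real,
      Real.norm_of_nonneg (div_nonneg hu.1 hB0.le)]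
    exact mul_lt_one_of_nonneg_of_lt_one_right (div_le_one_of_le₀ hu.2 hB0.le) (norm_nonneg _)
      (unitBall_norm_lt a)
  obtain ⟨z, hza⟩ : ∃ z : unitBall (Fin n), (z : EuclideanSpace ℂ (Fin n)) =
      ((u / B : ℝ) : ℂ) • (a : EuclideanSpace ℂ (Fin n)) := ⟨⟨_, hz⟩, rfl⟩
  have h1 := hself z
  have h2 := hker z
  have hBc : (B : ℂ) ≠ 0 := Complex.ofReal_ne_zero.2 hB0.ne'
  have huc : (1 - u : ℂ) ≠ 0 := by exact_mod_cast (sub_pos.2 hu1).ne'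
  simp only [hza, inner_smul_right, haB, Complex.ofReal_div, div_mul_cancel₀ _ hBc] at h1 h2
  have h3 : ⟪(b : EuclideanSpace ℂ (Fin n)), (g.1 z : EuclideanSpace ℂ (Fin n))⟫_ℂ =
      (B - u) / (1 - u) := by
    rw [eq_div_iff huc]
    linear_combination -h1
  rw [h3] at h2
  refine Complex.ofReal_injective ?_
  push_cast
  exact h2

theorem HasMonomialKernel.hermitianGroup_eq (hf : HasMonomialKernel c m f) (hc : ∀ j, 0 ≤ c j)
    (hsum : ∑ j, c j = 1) (hm : ∃ j, 2 ≤ m j ∧ c j ≠ 0) :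
    hermitianGroup f = unitaryAut n := by
  refine le_antisymm (fun g hg => ?_) hf.unitaryAut_le
  obtain ⟨U, hU⟩ := exists_linearIsometryEquiv_of_map_center g (hf.map_center hc hsum hm hg)
  exact ⟨U, Subtype.ext (Equiv.ext fun z => Subtype.ext (hU z).symm)⟩

theorem HasMonomialKernel.norm_sq_eq (hf : HasMonomialKernel c m f) (z : unitBall (Fin n)) :
    ‖(f z : EuclideanSpace ℂ κ)‖ ^ 2 =
      ∑ j, c j * (‖(z : EuclideanSpace ℂ (Fin n))‖ ^ 2) ^ m j := by
  have := hf z z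
  rw [inner_self_eq_norm_sq_to_K, inner_self_eq_norm_sq_to_K] at this
  refine Complex.ofReal_injective ?_
  simpa using this

theorem HasMonomialKernel.isProperMap (hf : HasMonomialKernel c m f) (hc : ∀ j, 0 ≤ c j)
    (hsum : ∑ j, c j = 1) (hcont : Continuous f) : IsProperMap f := by
  refine isProperMap_iff_isCompact_preimage.2 ⟨hcont, fun K hK => ?_⟩
  rcases K.eq_empty_or_nonempty with rfl | hne
  · simp
  obtain ⟨w, -, hw⟩ := hK.exists_isMaxOn hne
    (f := fun w : unitBall κ => ‖(w : EuclideanSpace ℂ κ)‖) (by fun_prop)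
  have hw1 : ‖(w : EuclideanSpace ℂ κ)‖ ^ 2 < 1 :=
    pow_lt_one₀ (norm_nonneg _) (unitBall_norm_lt w) two_ne_zero
  have hcont' : Continuous fun r : ℝ => ∑ j, c j * (r ^ 2) ^ m j := by fun_prop
  -- The squared norm of `f z` tends to 1 at the sphere, so some radius `r < 1` already exceeds the
  -- largest norm on `K`; the preimage of `K` stays within that radius.
  have hnhds : ∀ᶠ r in nhds (1 : ℝ), ‖(w : EuclideanSpace ℂ κ)‖ ^ 2 < ∑ j, c j * (r ^ 2) ^ m j :=
    hcont'.continuousAt.eventually_const_lt (by simpa [hsum] using hw1)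
  obtain ⟨r, hr, hr0, hr1⟩ :=
    ((hnhds.filter_mono nhdsWithin_le_nhds).and (Ioo_mem_nhdsLT (zero_lt_one' ℝ))).exists
  have hsub : f ⁻¹' K ⊆
      Subtype.val ⁻¹' Metric.closedBall (0 : EuclideanSpace ℂ (Fin n)) r := fun z hz => by
    rw [Set.mem_preimage, mem_closedBall_zero_iff]
    by_contra! hlt
    have h1 : ‖(f z : EuclideanSpace ℂ κ)‖ ^ 2 ≤ ‖(w : EuclideanSpace ℂ κ)‖ ^ 2 :=
      pow_le_pow_left₀ (norm_nonneg _) (hw hz) 2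
    rw [hf.norm_sq_eq] at h1
    refine (hr.trans_le ?_).not_ge h1
    exact Finset.sum_le_sum fun j _ => mul_le_mul_of_nonneg_left (by gcongr) (hc j)
  refine IsCompact.of_isClosed_subset ?_ (hK.isClosed.preimage hcont) hsub
  refine Topology.IsInducing.subtypeVal.isCompact_preimage' (isCompact_closedBall _ _) ?_
  rw [Subtype.range_coe]
  exact Metric.closedBall_subset_ball hr1

end MonomialKernel

/-! ### Kernels of tensor powers and their orthogonal sums -/

section TensorMaps

theorem inner_tensorPower (n m : ℕ) (z w : EuclideanSpace ℂ (Fin n)) :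
    ⟪tensorPower n m z, tensorPower n m w⟫_ℂ = ⟪z, w⟫_ℂ ^ m := by
  simp only [tensorPower, PiLp.inner_apply, RCLike.inner_apply, map_prod,
    ← Finset.prod_mul_distrib]
  rw [Finset.sum_pow']
  simp [Fintype.piFinset_univ]

theorem inner_juxtapose {E : Type} {k : ℕ} {κ : Fin k → Type} [∀ j, Fintype (κ j)]
    (lam : EuclideanSpace ℂ (Fin k)) (g : (j : Fin k) → E → EuclideanSpace ℂ (κ j)) (z w : E) :
    ⟪juxtapose lam g z, juxtapose lam g w⟫_ℂ =
      ∑ j, ((‖lam j‖ ^ 2 : ℝ) : ℂ) * ⟪g j z, g j w⟫_ℂ := by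
  simp only [juxtapose, PiLp.inner_apply, RCLike.inner_apply, map_mul, Fintype.sum_sigma,
    Finset.mul_sum, ← Complex.normSq_eq_norm_sq, ← Complex.mul_conj]
  exact Finset.sum_congr rfl fun j _ => Finset.sum_congr rfl fun i _ => by ring

theorem hasMonomialKernel_tensorPowerBall (n m : ℕ) (hm : m ≠ 0) :
    HasMonomialKernel (fun _ : Fin 1 => 1) (fun _ => m) (tensorPowerBall n m hm) := fun z w => by
  exact (inner_tensorPower n m z w).trans (by simp)

theorem hasMonomialKernel_tensorSumBall (n : ℕ) {k : ℕ} (lam : EuclideanSpace ℂ (Fin k))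
    (m : Fin k → ℕ) (hlam : ‖lam‖ = 1) (hm : ∃ j, m j ≠ 0 ∧ lam j ≠ 0) :
    HasMonomialKernel (fun j => ‖lam j‖ ^ 2) m (tensorSumBall n lam m hlam hm) := fun z w => by
  have h := inner_juxtapose lam (fun j => tensorPower n (m j)) (z : EuclideanSpace ℂ (Fin n)) w
  simp only [inner_tensorPower] at h
  exact h

theorem continuous_tensorPower (n m : ℕ) : Continuous (tensorPower n m) := by
  unfold tensorPower
  fun_prop

theorem continuous_tensorPowerBall (n m : ℕ) (hm : m ≠ 0) : Continuous (tensorPowerBall n m hm) :=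
  ((continuous_tensorPower n m).comp continuous_subtype_val).subtype_mk _

theorem continuous_tensorSumBall (n : ℕ) {k : ℕ} (lam : EuclideanSpace ℂ (Fin k))
    (m : Fin k → ℕ) (hlam : ‖lam‖ = 1) (hm : ∃ j, m j ≠ 0 ∧ lam j ≠ 0) :
    Continuous (tensorSumBall n lam m hlam hm) := by
  refine Continuous.subtype_mk ?_ _
  unfold juxtapose tensorPower
  fun_prop

theorem sum_norm_sq_eq_one {k : ℕ} {lam : EuclideanSpace ℂ (Fin k)} (hlam : ‖lam‖ = 1) :
    ∑ j, ‖lam j‖ ^ 2 = 1 := by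
  rw [← EuclideanSpace.norm_sq_eq, hlam, one_pow]

theorem hermitianGroup_tensorSumBall_zero_one (n : ℕ) (lam : EuclideanSpace ℂ (Fin 2))
    (hlam : ‖lam‖ = 1) (hm : ∃ j, (![0, 1] : Fin 2 → ℕ) j ≠ 0 ∧ lam j ≠ 0) :
    hermitianGroup (tensorSumBall n lam ![0, 1] hlam hm) = ⊤ := by
  refine (Subgroup.eq_top_iff' _).2 fun g => mem_hermitianGroup_iff.2 ?_
  obtain ⟨h, hh⟩ := automorphyRelated_ballAut g id
  have hsum : ((‖lam 0‖ ^ 2 : ℝ) : ℂ) + ((‖lam 1‖ ^ 2 : ℝ) : ℂ) = 1 := by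
    have := sum_norm_sq_eq_one hlam
    rw [Fin.sum_univ_two] at this
    exact_mod_cast this
  refine ⟨h, fun z w => ?_⟩
  have := hh z w
  simp only [id] at this
  simp only [hasMonomialKernel_tensorSumBall n lam ![0, 1] hlam hm _ _, Fin.sum_univ_two,
    Matrix.cons_val_zero, Matrix.cons_val_one, pow_zero, pow_one, mul_one]
  -- As `|λ₁|² + |λ₂|² = 1`, the kernel of `f` is `|λ₂|²` times that of the ball and inherits its
  -- automorphy factor.
  linear_combination ((‖lam 1‖ ^ 2 : ℝ) : ℂ) * this + (conj (h z) * h w - 1) * hsum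

theorem hermitianGroup_id {ι : Type} [Fintype ι] :
    hermitianGroup (id : unitBall ι → unitBall ι) = ⊤ :=
  (Subgroup.eq_top_iff' _).2 fun g => ⟨g, fun _ => rfl⟩

end TensorMaps

theorem theorem4p2 (n : ℕ) (hn : 1 ≤ n) :
    -- the identity map `f(z) = z`
    (IsProperMap (id : unitBall (Fin n) → unitBall (Fin n)) ∧
      hermitianGroup (id : unitBall (Fin n) → unitBall (Fin n)) = ⊤ ∧
      sourceRank (id : unitBall (Fin n) → unitBall (Fin n)) = 1) ∧
    -- the tensor powers `f(z) = z^{⊗m}` with `m ≥ 2`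
    (∀ (m : ℕ) (hm : m ≠ 0), 2 ≤ m →
      IsProperMap (tensorPowerBall n m hm) ∧
      hermitianGroup (tensorPowerBall n m hm) = unitaryAut n ∧
      sourceRank (tensorPowerBall n m hm) = 1) ∧
    -- the orthogonal sums in which some `m_j ≥ 2` occurs
    (∀ (k : ℕ) (lam : EuclideanSpace ℂ (Fin k)) (m : Fin k → ℕ) (hlam : ‖lam‖ = 1)
      (hm : ∃ j, m j ≠ 0 ∧ lam j ≠ 0), Function.Injective m → (∃ j, 2 ≤ m j ∧ lam j ≠ 0) →
      IsProperMap (tensorSumBall n lam m hlam hm) ∧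
      hermitianGroup (tensorSumBall n lam m hlam hm) = unitaryAut n ∧
      sourceRank (tensorSumBall n lam m hlam hm) = 1) ∧
    -- the sums `f(z) = λ₁ ⊕ λ₂ z`
    (∀ (lam : EuclideanSpace ℂ (Fin 2)) (hlam : ‖lam‖ = 1)
      (hm : ∃ j, (![0, 1] : Fin 2 → ℕ) j ≠ 0 ∧ lam j ≠ 0),
      IsProperMap (tensorSumBall n lam ![0, 1] hlam hm) ∧
      hermitianGroup (tensorSumBall n lam ![0, 1] hlam hm) = ⊤ ∧
      sourceRank (tensorSumBall n lam ![0, 1] hlam hm) = 1) := by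

  refine ⟨⟨isProperMap_id, hermitianGroup_id,
      sourceRank_eq_one hn (by rw [hermitianGroup_id]; exact le_top)⟩, ?_, ?_, ?_⟩
  · intro m hm hm2
    have hk := hasMonomialKernel_tensorPowerBall n m hm
    exact ⟨hk.isProperMap (fun _ => zero_le_one) (by simp) (continuous_tensorPowerBall n m hm),
      hk.hermitianGroup_eq (fun _ => zero_le_one) (by simp) ⟨0, hm2, one_ne_zero⟩,
      sourceRank_eq_one hn hk.unitaryAut_le⟩
  · rintro k lam m hlam hm - ⟨j, hj, hlj⟩
    have hk := hasMonomialKernel_tensorSumBall n lam m hlam hm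
    exact ⟨hk.isProperMap (fun _ => by positivity) (sum_norm_sq_eq_one hlam)
        (continuous_tensorSumBall n lam m hlam hm),
      hk.hermitianGroup_eq (fun _ => by positivity) (sum_norm_sq_eq_one hlam)
        ⟨j, hj, pow_ne_zero 2 (norm_ne_zero_iff.2 hlj)⟩,
      sourceRank_eq_one hn hk.unitaryAut_le⟩
  · intro lam hlam hm
    have hk := hasMonomialKernel_tensorSumBall n lam ![0, 1] hlam hm
    exact ⟨hk.isProperMap (fun _ => by positivity) (sum_norm_sq_eq_one hlam)
        (continuous_tensorSumBall n lam ![0, 1] hlam hm),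
      hermitianGroup_tensorSumBall_zero_one n lam hlam hm,
      sourceRank_eq_one hn hk.unitaryAut_le⟩
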